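/- Let $G$ be a hyperbolic group, i.e. $G$ is finitely generated and, for every finite generating set, the Cayley graph with its path metric has $\delta$-slim geodesic triangles for some $\delta\ge 0$. Let $S$ be a finite generating set, $d$ the path metric of the Cayley graph $\Gamma(G,S)$ on $G$, and $(x\cdot y)_p=\frac12\bigl(d(p,x)+d(p,y)-d(x,y)\bigr)$ the Gromov product. Let $M=\partial G$ be the Gromov boundary, i.e. the set of sequences $(x_n)$ in $G$ with $(x_m\cdot x_n)_p\to\infty$ as $m,n\to\infty$ for every $p$, modulo $(x_n)\sim(y_n)$ iff $(x_n\cdot y_n)_p\to\infty$ for every $p$; $G$ acts on $M$ by $g[(x_n)]=[(gx_n)]$. For $x\in G\cup M$ and $\lambda\in M$ put $(x\cdot \lambda)_p=\sup\liminf_{m,n\to\infty}(x_m\cdot y_n)_p$, the supremum being over all sequences $(x_m)$ representing $x$ (the constant sequence if $x\in G$) and $(y_n)$ representing $\lambda$. \emph{Gromov's topology} on $G\cup M$ is the one in which a set $W$ is open iff for every $\lambda\in W\cap M$ and every $p\in G$ there is $R\in\mathbb R$ with $\{x\in G\cup M : (x\cdot\lambda)_p>R\}\subset W$; $M$ carries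 the subspace topology. Assume that $M$ has more than two points, and let $(a,b,c)$ be any triple of pairwise distinct points of $M$. The \emph{convergence-group topology} on $G\cup M$ is the topology generated by all subsets of $G$ together with the sets $$\widetilde U_G=\{g\in G : \text{at least two of } ga,gb,gc \text{ lie in } U\}\cup U,\qquad U\subset M \text{ open}.$$ Then the convergence-group topology on $G\cup M$ coincides with Gromov's topology. -/

import Mathlib

open Filter Topology

/-! ### Hyperbolic graphs and their Gromov boundary -/

section HyperbolicGraph

variable {V : Type*} (Γ : SimpleGraph V)

/-- The walk `p` is a geodesic segment: its length is the distance of its endpoints. -/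
def IsGeodesicWalk {a b : V} (p : Γ.Walk a b) : Prop :=
  p.length = Γ.dist a b

/-- A graph with its path metric is hyperbolic if, for some `δ`, all geodesic triangles are
`δ`-slim: each side lies in the closed `δ`-neighbourhood of the union of the other two. -/
def IsHyperbolicGraph : Prop :=
  ∃ δ : ℕ, ∀ (a b c : V) (p : Γ.Walk a b) (q : Γ.Walk b c) (r : Γ.Walk c a),
    IsGeodesicWalk Γ p → IsGeodesicWalk Γ q → IsGeodesicWalk Γ r →
      ∀ v ∈ p.support, ∃ w, (w ∈ q.support ∨ w ∈ r.support) ∧ Γ.dist v w ≤ δ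

/-- The Gromov product `(x · y)_p = (d(p,x) + d(p,y) - d(x,y)) / 2` for the path metric. -/
noncomputable def gromovProduct (p x y : V) : ℝ :=
  ((Γ.dist p x : ℝ) + (Γ.dist p y : ℝ) - (Γ.dist x y : ℝ)) / 2

/-- `(x_m · x_n)_p → ∞` as `m, n → ∞`, for every base point `p`. -/
def IsGromovSequence (u : ℕ → V) : Prop :=
  ∀ p : V, Tendsto (fun mn : ℕ × ℕ => gromovProduct Γ p (u mn.1) (u mn.2)) atTop atTop

/-- The sequences that define boundary points. -/
def GromovSequence : Type _ :=
  {u : ℕ → V // IsGromovSequence Γ u}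

/-- `(x_n) ∼ (y_n)` if `(x_n · y_n)_p → ∞`, for every base point `p`. -/
def GromovEquivalent (u v : GromovSequence Γ) : Prop :=
  ∀ p : V, Tendsto (fun n : ℕ => gromovProduct Γ p (u.1 n) (v.1 n)) atTop atTop

/-- The Gromov boundary: sequences converging to infinity modulo `∼`
(which is an equivalence relation when `Γ` is connected and hyperbolic). -/
def GromovBoundary : Type _ :=
  Quot (GromovEquivalent Γ)

/-- The sequences representing a point of `V ∪ ∂Γ`: the constant sequence for a vertex, all
sequences in the class for a boundary point. -/
def Represents (u : ℕ → V) : V ⊕ GromovBoundary Γ → Prop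
  | Sum.inl x => ∀ n, u n = x
  | Sum.inr l => ∃ h : IsGromovSequence Γ u, Quot.mk (GromovEquivalent Γ) ⟨u, h⟩ = l

/-- The Gromov product on `V ∪ ∂Γ`: the supremum, over all sequences representing the two
points, of `liminf_{m,n → ∞} (x_m · y_n)_p`. -/
noncomputable def extendedGromovProduct (p : V) (x y : V ⊕ GromovBoundary Γ) : EReal :=
  ⨆ (u : ℕ → V) (v : ℕ → V) (_ : Represents Γ u x) (_ : Represents Γ v y),
    liminf (fun mn : ℕ × ℕ => ((gromovProduct Γ p (u mn.1) (v mn.2) : ℝ) : EReal)) atTop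

/-- Gromov's topology on `V ∪ ∂Γ`: vertices are isolated, and the sets
`{x | (x · l)_p > R}`, `R ∈ ℝ`, generate the neighbourhood filter of a boundary point `l`, so
that `x_n → l` means `(x_n · l)_p → ∞`. -/
@[reducible]
def gromovTopology : TopologicalSpace (V ⊕ GromovBoundary Γ) where
  IsOpen W := ∀ l : GromovBoundary Γ, Sum.inr l ∈ W → ∀ p : V, ∃ R : ℝ,
    ∀ x : V ⊕ GromovBoundary Γ, (R : EReal) < extendedGromovProduct Γ p x (Sum.inr l) → x ∈ W
  isOpen_univ := fun _ _ _ => ⟨0, fun _ _ => trivial⟩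
  isOpen_inter := by
    intro W W' hW hW' l hl p
    obtain ⟨R, hR⟩ := hW l hl.1 p
    obtain ⟨R', hR'⟩ := hW' l hl.2 p
    refine ⟨max R R', fun x hx => ⟨hR x (lt_of_le_of_lt ?_ hx), hR' x (lt_of_le_of_lt ?_ hx)⟩⟩
    · exact EReal.coe_le_coe_iff.2 (le_max_left _ _)
    · exact EReal.coe_le_coe_iff.2 (le_max_right _ _)
  isOpen_sUnion := by
    rintro 𝒲 h𝒲 l ⟨W, hW, hl⟩ p
    obtain ⟨R, hR⟩ := h𝒲 W hW l hl p
    exact ⟨R, fun x hx => ⟨W, hW, hR x hx⟩⟩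

/-- The topology of the Gromov boundary, as a subspace of `V ∪ ∂Γ`. -/
instance GromovBoundary.instTopologicalSpace : TopologicalSpace (GromovBoundary Γ) :=
  TopologicalSpace.induced Sum.inr (gromovTopology Γ)

end HyperbolicGraph

/-! ### Hyperbolic groups -/

section HyperbolicGroup

variable {G : Type*} [Group G]

/-- A group is hyperbolic if it is finitely generated and its Cayley graph with respect to any
finite set of generators is hyperbolic. -/
def IsHyperbolicGroup (G : Type*) [Group G] : Prop :=
  Group.FG G ∧ ∀ S : Set G, S.Finite → Subgroup.closure S = ⊤ →
    IsHyperbolicGraph (SimpleGraph.mulCayley S)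

/-- Left translation is an automorphism of the Cayley graph. -/
def cayleyHom (S : Set G) (g : G) : SimpleGraph.mulCayley S →g SimpleGraph.mulCayley S where
  toFun x := g * x
  map_rel' := by
    intro a b h
    rw [SimpleGraph.mulCayley_adj'] at h ⊢
    obtain ⟨hne, s, hs, h⟩ := h
    refine ⟨fun e => hne (mul_left_cancel e), s, hs, ?_⟩
    rcases h with h | h
    · exact Or.inl (by rw [mul_assoc, h])
    · exact Or.inr (by rw [mul_assoc, ← h])

theorem cayley_walk_translate (S : Set G) (g a b : G) (w : (SimpleGraph.mulCayley S).Walk a b) :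
    ∃ w' : (SimpleGraph.mulCayley S).Walk (g * a) (g * b), w'.length = w.length :=
  ⟨w.map (cayleyHom S g), SimpleGraph.Walk.length_map _ _⟩

theorem cayley_dist_mul_left (S : Set G) (g a b : G) :
    (SimpleGraph.mulCayley S).dist (g * a) (g * b) = (SimpleGraph.mulCayley S).dist a b := by
  rw [SimpleGraph.dist_eq_sInf, SimpleGraph.dist_eq_sInf]
  congr 1
  ext n
  constructor
  · rintro ⟨w, rfl⟩
    obtain ⟨w'', hw''⟩ : ∃ w'' : (SimpleGraph.mulCayley S).Walk a b, w''.length = w.length := by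
      have := cayley_walk_translate S g⁻¹ _ _ w
      rwa [inv_mul_cancel_left, inv_mul_cancel_left] at this
    exact ⟨w'', hw''⟩
  · rintro ⟨w, rfl⟩
    obtain ⟨w', hw'⟩ := cayley_walk_translate S g _ _ w
    exact ⟨w', hw'⟩

theorem gromovProduct_mul_left (S : Set G) (g p x y : G) :
    gromovProduct (SimpleGraph.mulCayley S) p (g * x) (g * y) =
      gromovProduct (SimpleGraph.mulCayley S) (g⁻¹ * p) x y := by
  have h : ∀ z, (SimpleGraph.mulCayley S).dist p (g * z) =
      (SimpleGraph.mulCayley S).dist (g⁻¹ * p) z := fun z => by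
    rw [← cayley_dist_mul_left S g (g⁻¹ * p) z, mul_inv_cancel_left]
  simp only [gromovProduct, h, cayley_dist_mul_left]

/-- Left translation of a sequence. -/
def GromovSequence.translate (S : Set G) (g : G)
    (u : GromovSequence (SimpleGraph.mulCayley S)) : GromovSequence (SimpleGraph.mulCayley S) :=
  ⟨fun n => g * u.1 n, fun p => by
    simp only [gromovProduct_mul_left]
    exact u.2 (g⁻¹ * p)⟩

/-- The action of `G` on the Gromov boundary of its Cayley graph: `g • [x_n] = [g x_n]`. -/
instance GromovBoundary.instMulAction (S : Set G) :
    MulAction G (GromovBoundary (SimpleGraph.mulCayley S)) where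
  smul g := Quot.map (GromovSequence.translate S g) (fun u v h p => by
    simp only [GromovSequence.translate, gromovProduct_mul_left]
    exact h (g⁻¹ * p))
  one_smul l := by
    induction l using Quot.ind with
    | mk u =>
      exact congrArg (Quot.mk _) (Subtype.ext (funext fun n => one_mul (u.1 n)))
  mul_smul g h l := by
    induction l using Quot.ind with
    | mk u =>
      exact congrArg (Quot.mk _) (Subtype.ext (funext fun n => mul_assoc g h (u.1 n)))

end HyperbolicGroup

/-! ### The topology on `G ∪ M` for a group acting on `M` -/

section ConvergenceTopology

/-- The space `T` of distinct triples of points of `M`. -/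
def DistinctTriples (M : Type*) : Type _ :=
  {t : M × M × M // t.1 ≠ t.2.1 ∧ t.2.1 ≠ t.2.2 ∧ t.2.2 ≠ t.1}

/-- At least two components of the triple lie in `U`. -/
def HasTwoComponentsIn {M : Type*} (a b c : M) (U : Set M) : Prop :=
  (a ∈ U ∧ b ∈ U) ∨ (b ∈ U ∧ c ∈ U) ∨ (c ∈ U ∧ a ∈ U)

variable (G : Type*) {M : Type*} [Group G] [MulAction G M]

/-- The set `{g ∈ G | g x has two components in U} ∪ U`, a subset of `G ∪ M`. -/
def tukiaNeighborhood (x : DistinctTriples M) (U : Set M) : Set (G ⊕ M) :=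
  Sum.inl '' {g : G | HasTwoComponentsIn (g • x.1.1) (g • x.1.2.1) (g • x.1.2.2) U} ∪
    Sum.inr '' U

/-- The topology on `G ∪ M` generated by all subsets of `G` and the sets
`tukiaNeighborhood G x U`, with `U` open in `M`. -/
@[reducible]
def convergenceGroupTopology [TopologicalSpace M] (x : DistinctTriples M) :
    TopologicalSpace (G ⊕ M) :=
  TopologicalSpace.generateFrom
    ({W | ∃ A : Set G, W = Sum.inl '' A} ∪
      {W | ∃ U : Set M, IsOpen U ∧ W = tukiaNeighborhood G x U})

end ConvergenceTopology

/-!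
Slim triangles give Gromov's four-point inequality `(x · z)_p ≥ min (x · y)_p (y · z)_p - δ` for
vertices (`IsHyperbolicGraph.exists_fourPointHyperbolic`). A lower bound on a product that involves
boundary points holds, up to a multiple of `δ`, eventually along any sequences representing them
(`FourPointHyperbolic.exists_lt_of_lt_extended`). So the inequality passes to `G ∪ ∂G`, and the
sets `{x | (x · l)_p > R}` form neighbourhood bases at the boundary points `l`.

Let `a, b, c` be distinct boundary points, and write `|g|` for the distance of `1` and `g`. By the
four-point inequality there is a constant `K` such that, for every `g`, at most one of the three
has Gromov product with `g⁻¹` based at `1` larger than `K`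
(`FourPointHyperbolic.forall_le_or_forall_le`). If `(a · g⁻¹)_1 ≤ K`, then
`(g a · g)_1 = |g| - (a · g⁻¹)_1 ≥ |g| - K`. Hence, for `|g|` large, at least two of the translates
`g a`, `g b`, `g c` are close to `g`.

* If `g` is close to `l`, then `|g| ≥ (g · l)_1` is large, and those two translates are close to
  `l`. So the sets `tukiaNeighborhood G x U` are open in Gromov's topology.
* If two of the translates, say `g a` and `g b`, are close to `l`, then
  `(g a · g b)_1 ≤ (a · b)_1 + |g|` is large, so `|g|` is large. As two translates are close to `l`
  and two are close to `g`, some translate is close to both, and `g` is close to `l`. So every set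
  that is open in Gromov's topology is a union of sets `tukiaNeighborhood G x U` and of subsets
  of `G`.

The second point is uniform in `g`: no finite set of group elements has to be discarded, and no
compactness enters.
-/

/-! ### From slim triangles to the four-point inequality -/

section FourPoint

variable {V : Type*} {Γ : SimpleGraph V}

/-- Hyperbolicity in the form in which it is used below: `Γ` is connected and its Gromov product
satisfies Gromov's four-point inequality with constant `δ`. -/
structure FourPointHyperbolic (Γ : SimpleGraph V) (δ : ℝ) : Prop where
  connected : Γ.Connected
  nonneg : 0 ≤ δ
  four_point : ∀ p x y z : V,
    min (gromovProduct Γ p x y) (gromovProduct Γ p y z) ≤ gromovProduct Γ p x z + δ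

theorem gromovProduct_comm (p x y : V) : gromovProduct Γ p x y = gromovProduct Γ p y x := by
  simp only [gromovProduct, Γ.dist_comm (u := x) (v := y)]
  ring

theorem dist_triangle_real (hc : Γ.Connected) (x y z : V) :
    (Γ.dist x z : ℝ) ≤ Γ.dist x y + Γ.dist y z := by
  exact_mod_cast hc.dist_triangle

theorem gromovProduct_le_dist (hc : Γ.Connected) (p x y : V) :
    gromovProduct Γ p x y ≤ Γ.dist p x := by
  have := dist_triangle_real hc p x y
  unfold gromovProduct
  linarith

theorem gromovProduct_le_add_dist (hc : Γ.Connected) (p q x y : V) :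
    gromovProduct Γ p x y ≤ gromovProduct Γ q x y + Γ.dist p q := by
  have h₁ := dist_triangle_real hc p q x
  have h₂ := dist_triangle_real hc p q y
  unfold gromovProduct
  linarith

theorem gromovProduct_add_gromovProduct (p q x : V) :
    gromovProduct Γ p x q + gromovProduct Γ q x p = Γ.dist p q := by
  simp only [gromovProduct, Γ.dist_comm (u := q) (v := p), Γ.dist_comm (u := x) (v := p),
    Γ.dist_comm (u := x) (v := q)]
  ring

theorem IsGeodesicWalk.dist_add_dist (hc : Γ.Connected) {x y v : V} {w : Γ.Walk x y}
    (hw : IsGeodesicWalk Γ w) (hv : v ∈ w.support) :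
    Γ.dist x v + Γ.dist v y = Γ.dist x y := by
  classical
  have h := congrArg SimpleGraph.Walk.length (w.take_spec hv)
  rw [SimpleGraph.Walk.length_append, hw] at h
  have h₁ := Γ.dist_le (w.takeUntil v hv)
  have h₂ := Γ.dist_le (w.dropUntil v hv)
  have h₃ : Γ.dist x y ≤ Γ.dist x v + Γ.dist v y := hc.dist_triangle
  omega

theorem gromovProduct_le_dist_of_mem_geodesic (hc : Γ.Connected) {x y v : V} {w : Γ.Walk x y}
    (hw : IsGeodesicWalk Γ w) (hv : v ∈ w.support) (p : V) :
    gromovProduct Γ p x y ≤ Γ.dist p v := by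
  have h : (Γ.dist x v + Γ.dist v y : ℝ) = Γ.dist x y := by
    exact_mod_cast hw.dist_add_dist hc hv
  have h₁ := dist_triangle_real hc p v x
  have h₂ := dist_triangle_real hc p v y
  rw [Γ.dist_comm (u := v) (v := x)] at h₁
  unfold gromovProduct
  linarith

/-- In a slim triangle with corners `p`, `x`, `y`, the side `[x, y]` passes, up to an error
controlled by `δ`, at distance `(x · y)_p` from `p`: walking along that side there is a vertex
near both other sides. -/
theorem exists_mem_geodesic_dist_le (hc : Γ.Connected) {δ : ℕ}
    (hδ : ∀ (a b c : V) (p : Γ.Walk a b) (q : Γ.Walk b c) (r : Γ.Walk c a),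
      IsGeodesicWalk Γ p → IsGeodesicWalk Γ q → IsGeodesicWalk Γ r →
        ∀ v ∈ p.support, ∃ w, (w ∈ q.support ∨ w ∈ r.support) ∧ Γ.dist v w ≤ δ)
    {x y : V} {w : Γ.Walk x y} (hw : IsGeodesicWalk Γ w) (p : V) :
    ∃ v ∈ w.support, (Γ.dist p v : ℝ) ≤ gromovProduct Γ p x y + (2 * δ + 2) := by
  obtain ⟨q, hq⟩ := hc.exists_walk_length_eq_dist y p
  obtain ⟨r, hr⟩ := hc.exists_walk_length_eq_dist p x
  have key : ∃ v ∈ w.support, (∃ s ∈ q.support, Γ.dist v s ≤ δ + 1) ∧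
      ∃ t ∈ r.support, Γ.dist v t ≤ δ + 1 := by
    by_cases hall : ∀ i ≤ w.length, ∃ t ∈ r.support, Γ.dist (w.getVert i) t ≤ δ
    · obtain ⟨t, ht, hyt⟩ := hall _ le_rfl
      rw [w.getVert_length] at hyt
      exact ⟨y, w.end_mem_support, ⟨y, q.start_mem_support, by simp⟩, t, ht, by omega⟩
    · push Not at hall
      classical
      -- the first vertex of `[x, y]` that is far from `[p, x]`, and its predecessor
      obtain ⟨hi, hfar⟩ := Nat.find_spec hall
      have hmin := fun m => Nat.find_min hall (m := m)
      generalize Nat.find hall = i at hi hfar hmin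
      obtain _ | j := i
      · have := hfar x r.end_mem_support
        simp at this
      · have hj := hmin j (Nat.lt_succ_self j)
        push Not at hj
        obtain ⟨t, ht, htj⟩ := hj (by omega)
        refine ⟨w.getVert (j + 1), w.getVert_mem_support _, ?_, t, ht, ?_⟩
        · obtain ⟨s, hs | hs, hd⟩ := hδ x y p w q r hw hq hr _ (w.getVert_mem_support (j + 1))
          · exact ⟨s, hs, by omega⟩
          · exact absurd (hfar s hs) (by omega)
        · have hadj := SimpleGraph.dist_eq_one_iff_adj.2
            (w.adj_getVert_succ (i := j) (by omega)).symm
          have := hc.dist_triangle (u := w.getVert (j + 1)) (v := w.getVert j) (w := t)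
          omega
  obtain ⟨v, hv, ⟨s, hs, hvs⟩, t, ht, hvt⟩ := key
  refine ⟨v, hv, ?_⟩
  have h₁ : (Γ.dist y s + Γ.dist s p : ℝ) = Γ.dist y p := by
    exact_mod_cast IsGeodesicWalk.dist_add_dist hc hq hs
  have h₂ : (Γ.dist p t + Γ.dist t x : ℝ) = Γ.dist p x := by
    exact_mod_cast IsGeodesicWalk.dist_add_dist hc hr ht
  have h₃ : (Γ.dist x v + Γ.dist v y : ℝ) = Γ.dist x y := by
    exact_mod_cast hw.dist_add_dist hc hv
  have h₄ := dist_triangle_real hc p s v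
  have h₅ := dist_triangle_real hc p t v
  have h₆ := dist_triangle_real hc v s y
  have h₇ := dist_triangle_real hc v t x
  have hvs' : (Γ.dist v s : ℝ) ≤ δ + 1 := by exact_mod_cast hvs
  have hvt' : (Γ.dist v t : ℝ) ≤ δ + 1 := by exact_mod_cast hvt
  simp only [gromovProduct]
  rw [Γ.dist_comm (u := s) (v := v)] at h₄
  rw [Γ.dist_comm (u := t) (v := v)] at h₅
  rw [Γ.dist_comm (u := v) (v := x)] at h₇
  rw [Γ.dist_comm (u := y) (v := s), Γ.dist_comm (u := s) (v := p),
    Γ.dist_comm (u := y) (v := p)] at h₁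
  linarith

theorem IsHyperbolicGraph.exists_fourPointHyperbolic (hc : Γ.Connected)
    (h : IsHyperbolicGraph Γ) : ∃ δ : ℝ, FourPointHyperbolic Γ δ := by
  obtain ⟨δ, hδ⟩ := h
  refine ⟨3 * δ + 2, hc, by positivity, fun p x y z => ?_⟩
  obtain ⟨w, hw⟩ := hc.exists_walk_length_eq_dist x z
  obtain ⟨q, hq⟩ := hc.exists_walk_length_eq_dist z y
  obtain ⟨r, hr⟩ := hc.exists_walk_length_eq_dist y x
  obtain ⟨v, hv, hpv⟩ := exists_mem_geodesic_dist_le hc hδ hw p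
  obtain ⟨s, hs, hvs⟩ := hδ x z y w q r hw hq hr v hv
  have hvs' : (Γ.dist v s : ℝ) ≤ δ := by exact_mod_cast hvs
  have hps := dist_triangle_real hc p v s
  rcases hs with hs | hs
  · have := gromovProduct_le_dist_of_mem_geodesic hc hq hs p
    rw [gromovProduct_comm] at this
    exact (min_le_right _ _).trans (by linarith)
  · have := gromovProduct_le_dist_of_mem_geodesic hc hr hs p
    rw [gromovProduct_comm] at this
    exact (min_le_left _ _).trans (by linarith)

theorem FourPointHyperbolic.lt_gromovProduct {δ : ℝ} (h : FourPointHyperbolic Γ δ)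
    {p x y z : V} {R : ℝ} (h₁ : R < gromovProduct Γ p x y) (h₂ : R < gromovProduct Γ p y z) :
    R - δ < gromovProduct Γ p x z := by
  have := (lt_min h₁ h₂).trans_le (h.four_point p x y z)
  linarith

end FourPoint

/-! ### The extended Gromov product in terms of representing sequences -/

section ExtendedProduct

variable {V : Type*} {Γ : SimpleGraph V} {δ : ℝ}

theorem represents_const (x : V) : Represents Γ (fun _ => x) (Sum.inl x) := fun _ => rfl

theorem exists_represents (x : V ⊕ GromovBoundary Γ) : ∃ u : ℕ → V, Represents Γ u x := by
  rcases x with x | l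
  · exact ⟨fun _ => x, fun _ => rfl⟩
  · induction l using Quot.ind with
    | mk u => exact ⟨u.1, u.2, rfl⟩

theorem IsGromovSequence.exists_lt {u : ℕ → V} (hu : IsGromovSequence Γ u) (p : V) (R : ℝ) :
    ∃ N, ∀ m ≥ N, ∀ n ≥ N, R < gromovProduct Γ p (u m) (u n) := by
  have := (hu p).eventually_gt_atTop R
  rwa [eventually_atTop_prod_self'] at this

theorem FourPointHyperbolic.equivalence (h : FourPointHyperbolic Γ δ) :
    Equivalence (GromovEquivalent Γ) where
  refl u p := by
    refine tendsto_atTop.2 fun R => ?_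
    obtain ⟨N, hN⟩ := u.2.exists_lt p R
    exact eventually_atTop.2 ⟨N, fun n hn => (hN n hn n hn).le⟩
  symm huv p := by
    simpa only [gromovProduct_comm] using huv p
  trans {u v w} huv hvw p := by
    refine tendsto_atTop.2 fun R => ?_
    filter_upwards [(huv p).eventually_gt_atTop (R + δ), (hvw p).eventually_gt_atTop (R + δ)]
      with n h₁ h₂
    have := h.lt_gromovProduct h₁ h₂
    linarith

theorem FourPointHyperbolic.exists_lt_of_represents (h : FourPointHyperbolic Γ δ)
    {u v : ℕ → V} {l : GromovBoundary Γ} (hu : Represents Γ u (Sum.inr l))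
    (hv : Represents Γ v (Sum.inr l)) (p : V) (R : ℝ) :
    ∃ N, ∀ m ≥ N, ∀ n ≥ N, R < gromovProduct Γ p (u m) (v n) := by
  obtain ⟨hu, rfl⟩ := hu
  obtain ⟨hv, huv⟩ := hv
  have huv := h.equivalence.symm ((h.equivalence.quot_mk_eq_iff _ _).1 huv)
  obtain ⟨N, hN⟩ := hu.exists_lt p (R + δ)
  obtain ⟨N', hN'⟩ := eventually_atTop.1 ((huv p).eventually_gt_atTop (R + δ))
  refine ⟨max N N', fun m hm n hn => ?_⟩
  have := h.lt_gromovProduct (hN m (le_of_max_le_left hm) n (le_of_max_le_left hn))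
    (hN' n (le_of_max_le_right hn))
  linarith

/-- Replacing a representing sequence by another one costs at most `δ` in a Gromov product. -/
theorem FourPointHyperbolic.exists_replace (h : FourPointHyperbolic Γ δ)
    {u v : ℕ → V} {x : V ⊕ GromovBoundary Γ} (hu : Represents Γ u x)
    (hv : Represents Γ v x) (p : V) (R : ℝ) :
    ∃ N, ∀ m ≥ N, ∀ n ≥ N, ∀ w, R < gromovProduct Γ p (u m) w →
      R - δ < gromovProduct Γ p (v n) w := by
  rcases x with x | l
  · refine ⟨0, fun m _ n _ w hw => ?_⟩
    rw [hu m] at hw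
    rw [hv n]
    linarith [h.nonneg]
  · obtain ⟨N, hN⟩ := h.exists_lt_of_represents hv hu p R
    exact ⟨N, fun m hm n hn w hw => h.lt_gromovProduct (hN n hn m hm) hw⟩

/-- A lower bound for the extended Gromov product, which is a supremum over all representing
sequences, persists up to `2δ` eventually along any choice of representing sequences. -/
theorem FourPointHyperbolic.exists_lt_of_lt_extended (h : FourPointHyperbolic Γ δ)
    {u v : ℕ → V} {x y : V ⊕ GromovBoundary Γ} (hu : Represents Γ u x) (hv : Represents Γ v y)
    {p : V} {R : ℝ} (hR : (R : EReal) < extendedGromovProduct Γ p x y) :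
    ∃ N, ∀ m ≥ N, ∀ n ≥ N, R - 2 * δ < gromovProduct Γ p (u m) (v n) := by
  simp only [extendedGromovProduct, lt_iSup_iff] at hR
  obtain ⟨u', v', hu', hv', hR⟩ := hR
  have hR := eventually_lt_of_lt_liminf hR
  rw [eventually_atTop_prod_self'] at hR
  obtain ⟨N₀, h₀⟩ := hR
  obtain ⟨N₁, h₁⟩ := h.exists_replace hu' hu p R
  obtain ⟨N₂, h₂⟩ := h.exists_replace hv' hv p (R - δ)
  refine ⟨max N₁ N₂, fun m hm n hn => ?_⟩
  have hk₀ : max N₀ (max N₁ N₂) ≥ N₀ := le_max_left _ _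
  have hk₁ : max N₀ (max N₁ N₂) ≥ N₁ := (le_max_left _ _).trans (le_max_right _ _)
  have hk₂ : max N₀ (max N₁ N₂) ≥ N₂ := (le_max_right _ _).trans (le_max_right _ _)
  have e₀ := EReal.coe_lt_coe_iff.1 (h₀ _ hk₀ _ hk₀)
  have e₁ := h₁ _ hk₁ m (le_of_max_le_left hm) _ e₀
  rw [gromovProduct_comm] at e₁
  have e₂ := h₂ _ hk₂ n (le_of_max_le_right hn) _ e₁
  rw [gromovProduct_comm] at e₂
  linarith

theorem lt_extended_of_forall_lt {u v : ℕ → V} {x y : V ⊕ GromovBoundary Γ}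
    (hu : Represents Γ u x) (hv : Represents Γ v y) {p : V} {R R' : ℝ} (hRR : R' < R)
    {N : ℕ} (hN : ∀ m ≥ N, ∀ n ≥ N, R < gromovProduct Γ p (u m) (v n)) :
    (R' : EReal) < extendedGromovProduct Γ p x y := by
  refine (EReal.coe_lt_coe_iff.2 hRR).trans_le ?_
  have : (R : EReal) ≤ liminf (fun mn : ℕ × ℕ =>
      ((gromovProduct Γ p (u mn.1) (v mn.2) : ℝ) : EReal)) atTop := by
    refine le_liminf_of_le (by isBoundedDefault) ?_
    rw [eventually_atTop_prod_self']
    exact ⟨N, fun m hm n hn => EReal.coe_le_coe_iff.2 (hN m hm n hn).le⟩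
  exact this.trans (le_iSup_of_le u (le_iSup_of_le v (le_iSup_of_le hu (le_iSup_of_le hv le_rfl))))

theorem FourPointHyperbolic.lt_extended_self (h : FourPointHyperbolic Γ δ) (p : V)
    (l : GromovBoundary Γ) (R : ℝ) :
    (R : EReal) < extendedGromovProduct Γ p (Sum.inr l) (Sum.inr l) := by
  obtain ⟨u, hu⟩ := exists_represents (Sum.inr l : V ⊕ GromovBoundary Γ)
  obtain ⟨N, hN⟩ := h.exists_lt_of_represents hu hu p (R + 1)
  exact lt_extended_of_forall_lt hu hu (by linarith) hN

/-- The four-point inequality for the extended Gromov product, with a larger constant. -/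
theorem FourPointHyperbolic.lt_extended_trans (h : FourPointHyperbolic Γ δ) {p : V}
    {x y z : V ⊕ GromovBoundary Γ} {R : ℝ}
    (hxy : ((R + (3 * δ + 1) : ℝ) : EReal) < extendedGromovProduct Γ p x y)
    (hyz : ((R + (3 * δ + 1) : ℝ) : EReal) < extendedGromovProduct Γ p y z) :
    (R : EReal) < extendedGromovProduct Γ p x z := by
  obtain ⟨u, hu⟩ := exists_represents x
  obtain ⟨v, hv⟩ := exists_represents y
  obtain ⟨w, hw⟩ := exists_represents z
  obtain ⟨N, hN⟩ := h.exists_lt_of_lt_extended hu hv hxy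
  obtain ⟨N', hN'⟩ := h.exists_lt_of_lt_extended hv hw hyz
  refine lt_extended_of_forall_lt (R := R + 1) (N := max N N') hu hw (by linarith)
    fun m hm n hn => ?_
  have := h.lt_gromovProduct (hN m (le_of_max_le_left hm) _ (le_max_left N N'))
    (hN' _ (le_max_right N N') n (le_of_max_le_right hn))
  linarith

theorem FourPointHyperbolic.lt_extended_basepoint (h : FourPointHyperbolic Γ δ) {p q : V}
    {x y : V ⊕ GromovBoundary Γ} {R : ℝ}
    (hxy : ((R + (2 * δ + 1 + Γ.dist p q) : ℝ) : EReal) < extendedGromovProduct Γ p x y) :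
    (R : EReal) < extendedGromovProduct Γ q x y := by
  obtain ⟨u, hu⟩ := exists_represents x
  obtain ⟨v, hv⟩ := exists_represents y
  obtain ⟨N, hN⟩ := h.exists_lt_of_lt_extended hu hv hxy
  refine lt_extended_of_forall_lt (R := R + 1) (N := N) hu hv (by linarith) fun m hm n hn => ?_
  have h₁ := hN m hm n hn
  have h₂ := gromovProduct_le_add_dist h.connected p q (u m) (v n)
  linarith

/-- Sequences representing distinct boundary points have eventually bounded Gromov products. -/
theorem FourPointHyperbolic.exists_le_of_ne (h : FourPointHyperbolic Γ δ) {a b : GromovBoundary Γ}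
    (hab : a ≠ b) {u v : ℕ → V} (hu : Represents Γ u (Sum.inr a))
    (hv : Represents Γ v (Sum.inr b)) (p : V) :
    ∃ K : ℝ, ∃ N, ∀ m ≥ N, ∀ n ≥ N, gromovProduct Γ p (u m) (v n) ≤ K := by
  by_contra hcon
  push Not at hcon
  apply hab
  obtain ⟨hu, rfl⟩ := hu
  obtain ⟨hv, rfl⟩ := hv
  refine Quot.sound fun q => tendsto_atTop.2 fun R => ?_
  -- two applications of the four-point inequality, based at `q`, cost `2 * δ`
  set T : ℝ := R + 2 * δ with hT
  obtain ⟨N, hN⟩ := hu.exists_lt q T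
  obtain ⟨N', hN'⟩ := hv.exists_lt q T
  obtain ⟨m, hm, n, hn, hmn⟩ := hcon (T + Γ.dist p q) (max N N')
  have h₀ : T < gromovProduct Γ q (u m) (v n) := by
    linarith [gromovProduct_le_add_dist h.connected p q (u m) (v n)]
  refine eventually_atTop.2 ⟨max N N', fun k hk => ?_⟩
  have h₁ := h.lt_gromovProduct (hN k (le_of_max_le_left hk) m (le_of_max_le_left hm)) h₀
  have h₂ := h.lt_gromovProduct h₁ (z := v k)
    (by linarith [hN' n (le_of_max_le_right hn) k (le_of_max_le_right hk), h.nonneg])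
  change R ≤ gromovProduct Γ q (u k) (v k)
  linarith

/-- A vertex cannot be close to two distinct boundary points, as seen from `p`. -/
theorem FourPointHyperbolic.forall_le_or_forall_le (h : FourPointHyperbolic Γ δ) {u v : ℕ → V}
    {p : V} {K : ℝ} {N : ℕ} (hK : ∀ m ≥ N, ∀ n ≥ N, gromovProduct Γ p (u m) (v n) ≤ K) (q : V) :
    (∃ N, ∀ n ≥ N, gromovProduct Γ p (u n) q ≤ K + δ) ∨
      ∃ N, ∀ n ≥ N, gromovProduct Γ p (v n) q ≤ K + δ := by
  by_contra hcon
  push Not at hcon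
  obtain ⟨m, hm, h₁⟩ := hcon.1 N
  obtain ⟨n, hn, h₂⟩ := hcon.2 N
  rw [gromovProduct_comm] at h₂
  linarith [hK m hm n hn, h.lt_gromovProduct h₁ h₂]

end ExtendedProduct

/-! ### Neighbourhoods of boundary points in Gromov's topology -/

section GromovTopology

variable {V : Type*} {Γ : SimpleGraph V} {δ : ℝ}

theorem FourPointHyperbolic.isOpen_iff (h : FourPointHyperbolic Γ δ) (p : V)
    {W : Set (V ⊕ GromovBoundary Γ)} :
    IsOpen[gromovTopology Γ] W ↔ ∀ l : GromovBoundary Γ, Sum.inr l ∈ W → ∃ R : ℝ,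
      ∀ x : V ⊕ GromovBoundary Γ, (R : EReal) < extendedGromovProduct Γ p x (Sum.inr l) →
        x ∈ W := by
  refine ⟨fun hW l hl => hW l hl p, fun hW l hl q => ?_⟩
  obtain ⟨R, hR⟩ := hW l hl
  exact ⟨R + (2 * δ + 1 + Γ.dist q p), fun x hx => hR x (h.lt_extended_basepoint hx)⟩

/-- Every boundary point `l` has an open neighbourhood in the boundary contained in
`{m | (m · l)_p > R}`. -/
theorem FourPointHyperbolic.exists_isOpen_subset (h : FourPointHyperbolic Γ δ) (p : V)
    (l : GromovBoundary Γ) (R : ℝ) :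
    ∃ U : Set (GromovBoundary Γ), IsOpen U ∧ l ∈ U ∧
      ∀ m ∈ U, (R : EReal) < extendedGromovProduct Γ p (Sum.inr m) (Sum.inr l) := by
  -- the interior of `{y | (y · l)_p > R}`
  let W : Set (V ⊕ GromovBoundary Γ) := {x | ∃ T : ℝ, ∀ y : V ⊕ GromovBoundary Γ,
    (T : EReal) < extendedGromovProduct Γ p y x →
      (R : EReal) < extendedGromovProduct Γ p y (Sum.inr l)}
  have hW : IsOpen[gromovTopology Γ] W := by
    refine (h.isOpen_iff p).2 fun m hm => ?_
    obtain ⟨T, hT⟩ := hm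
    exact ⟨T + (3 * δ + 1), fun x hx => ⟨T + (3 * δ + 1), fun y hy =>
      hT y (h.lt_extended_trans hy hx)⟩⟩
  refine ⟨Sum.inr ⁻¹' W, ⟨W, hW, rfl⟩, ⟨R, fun _ hy => hy⟩, ?_⟩
  rintro m ⟨T, hT⟩
  exact hT _ (h.lt_extended_self p m T)

theorem FourPointHyperbolic.exists_forall_mem_of_isOpen (h : FourPointHyperbolic Γ δ) (p : V)
    {U : Set (GromovBoundary Γ)} (hU : IsOpen U) {l : GromovBoundary Γ} (hl : l ∈ U) :
    ∃ R : ℝ, ∀ m : GromovBoundary Γ,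
      (R : EReal) < extendedGromovProduct Γ p (Sum.inr m) (Sum.inr l) → m ∈ U := by
  obtain ⟨W, hW, rfl⟩ := hU
  obtain ⟨R, hR⟩ := (h.isOpen_iff p).1 hW l hl
  exact ⟨R, fun m hm => hR _ hm⟩

end GromovTopology

/-! ### Translates of a triple of boundary points -/

section Translates

open SimpleGraph (mulCayley)

variable {G : Type*} [Group G] {S : Set G} {δ : ℝ}

theorem mulCayley_reachable_mul_left (g : G) {a b : G} (h : (mulCayley S).Reachable a b) :
    (mulCayley S).Reachable (g * a) (g * b) := by
  obtain ⟨w⟩ := h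
  exact ⟨w.map (cayleyHom S g)⟩

theorem mulCayley_connected (hgen : Subgroup.closure S = ⊤) : (mulCayley S).Connected := by
  have h1 : ∀ g : G, (mulCayley S).Reachable 1 g := by
    intro g
    have hg : g ∈ Subgroup.closure S := hgen ▸ Subgroup.mem_top g
    induction hg using Subgroup.closure_induction with
    | mem s hs =>
      by_cases h : (1 : G) = s
      · rw [h]
      · exact SimpleGraph.Adj.reachable
          ((SimpleGraph.mulCayley_adj' S 1 s).2 ⟨h, s, hs, Or.inl (one_mul s)⟩)
    | one => exact SimpleGraph.Reachable.refl 1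
    | mul a b _ _ ha hb =>
      have := mulCayley_reachable_mul_left a hb
      rw [mul_one] at this
      exact ha.trans this
    | inv a _ ha =>
      have := mulCayley_reachable_mul_left a⁻¹ ha
      rw [mul_one, inv_mul_cancel] at this
      exact this.symm
  have : Nonempty G := ⟨1⟩
  exact ⟨fun a b => (h1 a).symm.trans (h1 b)⟩

theorem Represents.smul {u : ℕ → G} {a : GromovBoundary (mulCayley S)}
    (hu : Represents (mulCayley S) u (Sum.inr a)) (g : G) :
    Represents (mulCayley S) (fun n => g * u n) (Sum.inr (g • a)) := by
  obtain ⟨hu, rfl⟩ := hu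
  exact ⟨(GromovSequence.translate S g ⟨u, hu⟩).2, rfl⟩

/-- If `y` stays away from `g⁻¹`, then `g y` is as close to `g` as the size of `g` permits. -/
theorem dist_sub_le_gromovProduct_mul {K : ℝ} {g y : G}
    (h : gromovProduct (mulCayley S) 1 y g⁻¹ ≤ K) :
    ((mulCayley S).dist 1 g : ℝ) - K ≤ gromovProduct (mulCayley S) 1 (g * y) g := by
  have h₁ := gromovProduct_mul_left S g 1 y 1
  have h₂ := gromovProduct_add_gromovProduct (Γ := mulCayley S) 1 g⁻¹ y
  have h₃ := cayley_dist_mul_left S g 1 g⁻¹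
  rw [mul_one, mul_one] at h₁
  rw [mul_one, mul_inv_cancel, SimpleGraph.dist_comm] at h₃
  rw [h₁, h₃]
  linarith

variable {g : G} {u : ℕ → G} {a l : GromovBoundary (mulCayley S)} {K : ℝ}

theorem FourPointHyperbolic.lt_extended_smul (h : FourPointHyperbolic (mulCayley S) δ)
    (hu : Represents (mulCayley S) u (Sum.inr a))
    (hK : ∃ N, ∀ n ≥ N, gromovProduct (mulCayley S) 1 (u n) g⁻¹ ≤ K) (hK0 : 0 ≤ K) {R : ℝ}
    (hg : ((R + K + 3 * δ + 1 : ℝ) : EReal) <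
      extendedGromovProduct (mulCayley S) 1 (Sum.inl g) (Sum.inr l)) :
    (R : EReal) < extendedGromovProduct (mulCayley S) 1 (Sum.inr (g • a)) (Sum.inr l) := by
  obtain ⟨N, hK⟩ := hK
  obtain ⟨v, hv⟩ := exists_represents (Sum.inr l : G ⊕ GromovBoundary (mulCayley S))
  obtain ⟨N', hN'⟩ := h.exists_lt_of_lt_extended (represents_const g) hv hg
  refine lt_extended_of_forall_lt (R := R + 1 / 2) (N := max N N') (hu.smul g) hv (by linarith)
    fun m hm n hn => ?_
  have h₁ := dist_sub_le_gromovProduct_mul (hK m (le_of_max_le_left hm))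
  have h₂ := hN' n (le_of_max_le_right hn) n (le_of_max_le_right hn)
  have h₃ := gromovProduct_le_dist h.connected 1 g (v n)
  have := h.lt_gromovProduct (R := R + δ + 1 / 2) (p := 1) (x := g * u m) (y := g) (z := v n)
    (by linarith) (by linarith)
  linarith

theorem FourPointHyperbolic.lt_extended_of_smul (h : FourPointHyperbolic (mulCayley S) δ)
    (hu : Represents (mulCayley S) u (Sum.inr a))
    (hK : ∃ N, ∀ n ≥ N, gromovProduct (mulCayley S) 1 (u n) g⁻¹ ≤ K) {R : ℝ}
    (hdist : R + K + δ + 1 < (mulCayley S).dist 1 g)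
    (hg : ((R + 3 * δ + 1 : ℝ) : EReal) <
      extendedGromovProduct (mulCayley S) 1 (Sum.inr (g • a)) (Sum.inr l)) :
    (R : EReal) < extendedGromovProduct (mulCayley S) 1 (Sum.inl g) (Sum.inr l) := by
  obtain ⟨N, hK⟩ := hK
  obtain ⟨v, hv⟩ := exists_represents (Sum.inr l : G ⊕ GromovBoundary (mulCayley S))
  obtain ⟨N', hN'⟩ := h.exists_lt_of_lt_extended (hu.smul g) hv hg
  refine lt_extended_of_forall_lt (R := R + 1 / 2) (N := max N N') (represents_const g)
    hv (by linarith) fun m hm n hn => ?_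
  have h₁ := dist_sub_le_gromovProduct_mul (hK m (le_of_max_le_left hm))
  have h₂ := hN' m (le_of_max_le_right hm) n (le_of_max_le_right hn)
  rw [gromovProduct_comm] at h₁
  have := h.lt_gromovProduct (R := R + δ + 1 / 2) (p := 1) (x := g) (y := g * u m) (z := v n)
    (by linarith) (by linarith)
  linarith

/-- If `g` moves two points at bounded Gromov product close to the same boundary point, then `g`
is large. -/
theorem FourPointHyperbolic.lt_dist_of_smul (h : FourPointHyperbolic (mulCayley S) δ) {v : ℕ → G}
    {b : GromovBoundary (mulCayley S)}
    (hu : Represents (mulCayley S) u (Sum.inr a))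
    (hv : Represents (mulCayley S) v (Sum.inr b)) {N : ℕ}
    (hK : ∀ m ≥ N, ∀ n ≥ N, gromovProduct (mulCayley S) 1 (u m) (v n) ≤ K) {R : ℝ}
    (ha : ((R + K + 3 * δ : ℝ) : EReal) <
      extendedGromovProduct (mulCayley S) 1 (Sum.inr (g • a)) (Sum.inr l))
    (hb : ((R + K + 3 * δ : ℝ) : EReal) <
      extendedGromovProduct (mulCayley S) 1 (Sum.inr (g • b)) (Sum.inr l)) :
    R < (mulCayley S).dist 1 g := by
  obtain ⟨w, hw⟩ := exists_represents (Sum.inr l : G ⊕ GromovBoundary (mulCayley S))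
  obtain ⟨N₁, h₁⟩ := h.exists_lt_of_lt_extended (hu.smul g) hw ha
  obtain ⟨N₂, h₂⟩ := h.exists_lt_of_lt_extended (hv.smul g) hw hb
  have hk : max N (max N₁ N₂) ≥ N := le_max_left _ _
  have hk₁ : max N (max N₁ N₂) ≥ N₁ := (le_max_left _ _).trans (le_max_right _ _)
  have hk₂ : max N (max N₁ N₂) ≥ N₂ := (le_max_right _ _).trans (le_max_right _ _)
  generalize max N (max N₁ N₂) = k at hk hk₁ hk₂
  have e₂ := h₂ k hk₂ k hk₂
  rw [gromovProduct_comm] at e₂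
  have e := h.lt_gromovProduct (h₁ k hk₁ k hk₁) e₂
  rw [gromovProduct_mul_left, mul_one] at e
  have e₃ := gromovProduct_le_add_dist h.connected g⁻¹ 1 (u k) (v k)
  have e₄ := cayley_dist_mul_left S g g⁻¹ 1
  rw [mul_one, mul_inv_cancel] at e₄
  rw [← e₄] at e₃
  linarith [hK k hk k hk]

theorem two_of_three {p q r A B C : Prop} (h : (p ∨ q) ∧ (q ∨ r) ∧ (r ∨ p))
    (hA : p → A) (hB : q → B) (hC : r → C) : (A ∧ B) ∨ (B ∧ C) ∨ (C ∧ A) := by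
  obtain ⟨h₁ | h₁, h₂ | h₂, h₃ | h₃⟩ := h <;> simp [*]

theorem of_two_of_three {p q r A B C D : Prop} (h : (p ∨ q) ∧ (q ∨ r) ∧ (r ∨ p))
    (h' : (A ∧ B) ∨ (B ∧ C) ∨ (C ∧ A)) (hA : p → A → D) (hB : q → B → D) (hC : r → C → D) :
    D := by
  tauto

/-- Convergence `g → l` in Gromov's sense holds exactly when at least two of the three translates
`g a`, `g b`, `g c` converge to `l`; the two implications are the two conjuncts. -/
theorem FourPointHyperbolic.hasTwoComponentsIn (h : FourPointHyperbolic (mulCayley S) δ)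
    (x : DistinctTriples (GromovBoundary (mulCayley S))) (l : GromovBoundary (mulCayley S))
    (R : ℝ) :
    (∃ T : ℝ, ∀ g : G,
      (T : EReal) < extendedGromovProduct (mulCayley S) 1 (Sum.inl g) (Sum.inr l) →
      HasTwoComponentsIn (g • x.1.1) (g • x.1.2.1) (g • x.1.2.2)
        {m | (R : EReal) < extendedGromovProduct (mulCayley S) 1 (Sum.inr m) (Sum.inr l)}) ∧
    ∃ T : ℝ, ∀ g : G, HasTwoComponentsIn (g • x.1.1) (g • x.1.2.1) (g • x.1.2.2)
        {m | (T : EReal) < extendedGromovProduct (mulCayley S) 1 (Sum.inr m) (Sum.inr l)} →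
      (R : EReal) < extendedGromovProduct (mulCayley S) 1 (Sum.inl g) (Sum.inr l) := by
  obtain ⟨⟨a, b, c⟩, hab, hbc, hca⟩ := x
  dsimp only at hab hbc hca ⊢
  obtain ⟨u, hu⟩ := exists_represents (Sum.inr a : G ⊕ GromovBoundary (mulCayley S))
  obtain ⟨v, hv⟩ := exists_represents (Sum.inr b : G ⊕ GromovBoundary (mulCayley S))
  obtain ⟨w, hw⟩ := exists_represents (Sum.inr c : G ⊕ GromovBoundary (mulCayley S))
  obtain ⟨K₁, N₁, h₁⟩ := h.exists_le_of_ne hab hu hv 1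
  obtain ⟨K₂, N₂, h₂⟩ := h.exists_le_of_ne hbc hv hw 1
  obtain ⟨K₃, N₃, h₃⟩ := h.exists_le_of_ne hca hw hu 1
  obtain ⟨K, hK0, hK₁, hK₂, hK₃⟩ : ∃ K : ℝ, 0 ≤ K ∧ K₁ ≤ K ∧ K₂ ≤ K ∧ K₃ ≤ K :=
    ⟨max 0 (max K₁ (max K₂ K₃)), by simp, by simp, by simp, by simp⟩
  replace h₁ := fun m hm n hn => (h₁ m hm n hn).trans hK₁
  replace h₂ := fun m hm n hn => (h₂ m hm n hn).trans hK₂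
  replace h₃ := fun m hm n hn => (h₃ m hm n hn).trans hK₃
  have hδ := h.nonneg
  have hKδ : 0 ≤ K + δ := by linarith
  -- at most one of the three points is close to `g⁻¹`
  have two (g : G) := And.intro (h.forall_le_or_forall_le h₁ g⁻¹)
    (And.intro (h.forall_le_or_forall_le h₂ g⁻¹) (h.forall_le_or_forall_le h₃ g⁻¹))
  constructor
  · refine ⟨R + (K + δ) + 3 * δ + 1, fun g hg => ?_⟩
    have ha := fun e => h.lt_extended_smul (g := g) hu e hKδ hg
    have hb := fun e => h.lt_extended_smul (g := g) hv e hKδ hg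
    have hc := fun e => h.lt_extended_smul (g := g) hw e hKδ hg
    exact two_of_three (two g) ha hb hc
  · -- the threshold forces `dist 1 g > R + (K + δ) + δ + 1`, and is at least `R + 3 * δ + 1`
    set T : ℝ := (R + (K + δ) + δ + 1) + K + 3 * δ with hT
    refine ⟨T, fun g hg => ?_⟩
    have hdist : R + (K + δ) + δ + 1 < (mulCayley S).dist 1 g := by
      rcases hg with ⟨e, e'⟩ | ⟨e, e'⟩ | ⟨e, e'⟩
      · exact h.lt_dist_of_smul hu hv h₁ e e'
      · exact h.lt_dist_of_smul hv hw h₂ e e'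
      · exact h.lt_dist_of_smul hw hu h₃ e e'
    have hTR : ((R + 3 * δ + 1 : ℝ) : EReal) ≤ T := EReal.coe_le_coe_iff.2 (by linarith)
    have ha := fun e e' => h.lt_extended_of_smul (l := l) hu e hdist (hTR.trans_lt e')
    have hb := fun e e' => h.lt_extended_of_smul (l := l) hv e hdist (hTR.trans_lt e')
    have hc := fun e e' => h.lt_extended_of_smul (l := l) hw e hdist (hTR.trans_lt e')
    exact of_two_of_three (two g) hg ha hb hc

theorem HasTwoComponentsIn.mono {M : Type*} {a b c : M} {U U' : Set M} (hU : U ⊆ U')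
    (h : HasTwoComponentsIn a b c U) : HasTwoComponentsIn a b c U' :=
  h.imp (And.imp (@hU a) (@hU b)) (Or.imp (And.imp (@hU b) (@hU c)) (And.imp (@hU c) (@hU a)))

end Translates

/-! ### Comparison of the two topologies -/

theorem mainTheorem8 {G : Type*} [Group G] (hG : IsHyperbolicGroup G)
    (S : Set G) (hS : S.Finite) (hgen : Subgroup.closure S = ⊤)
    (hM : 2 < ENat.card (GromovBoundary (SimpleGraph.mulCayley S)))
    (x : DistinctTriples (GromovBoundary (SimpleGraph.mulCayley S))) :
    convergenceGroupTopology G x = gromovTopology (SimpleGraph.mulCayley S) := by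
  obtain ⟨δ, h⟩ := IsHyperbolicGraph.exists_fourPointHyperbolic (mulCayley_connected hgen)
    (hG.2 S hS hgen)
  apply le_antisymm
  · intro W hW
    let := convergenceGroupTopology G x
    refine isOpen_iff_forall_mem_open.2 ?_
    rintro (g | l) hl
    · refine ⟨Sum.inl '' {g}, ?_, TopologicalSpace.isOpen_generateFrom_of_mem
        (Or.inl ⟨{g}, rfl⟩), by simp⟩
      rintro _ ⟨_, rfl, rfl⟩
      exact hl
    · obtain ⟨R, hR⟩ := (h.isOpen_iff 1).1 hW l hl
      obtain ⟨T, hT⟩ := (h.hasTwoComponentsIn x l R).2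
      obtain ⟨U, hU, hlU, hUT⟩ := h.exists_isOpen_subset 1 l (max R T)
      refine ⟨tukiaNeighborhood G x U, ?_, TopologicalSpace.isOpen_generateFrom_of_mem
        (Or.inr ⟨U, hU, rfl⟩), Or.inr ⟨l, hlU, rfl⟩⟩
      rintro _ (⟨g, hg, rfl⟩ | ⟨m, hm, rfl⟩)
      · exact hR _ (hT g (hg.mono fun m hm =>
          (EReal.coe_le_coe_iff.2 (le_max_right R T)).trans_lt (hUT m hm)))
      · exact hR _ ((EReal.coe_le_coe_iff.2 (le_max_left R T)).trans_lt (hUT m hm))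
  · refine TopologicalSpace.le_generateFrom_iff_subset_isOpen.2 ?_
    rintro _ (⟨A, rfl⟩ | ⟨U, hU, rfl⟩)
    · rintro l ⟨_, _, hl⟩
      cases hl
    · refine (h.isOpen_iff 1).2 fun l hl => ?_
      obtain ⟨_, _, hl⟩ | ⟨_, hlU, hl⟩ := hl
      · cases hl
      cases hl
      obtain ⟨R, hR⟩ := h.exists_forall_mem_of_isOpen 1 hU hlU
      obtain ⟨T, hT⟩ := (h.hasTwoComponentsIn x l R).1
      refine ⟨max R T, ?_⟩
      rintro (g | m) hx
      · exact Or.inl ⟨g, (hT g ((EReal.coe_le_coe_iff.2 (le_max_right R T)).trans_lt hx)).mono hR,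
          rfl⟩
      · exact Or.inr ⟨m, hR m ((EReal.coe_le_coe_iff.2 (le_max_left R T)).trans_lt hx), rfl⟩
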